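/- Let $\mathcal H$ be a finite-dimensional real or complex inner product space. For subspaces $\mathcal X,\mathcal Y\subseteq\mathcal H$ with orthogonal projectors $P_{\mathcal X},P_{\mathcal Y}$ and $m=\min\{\dim\mathcal X,\dim\mathcal Y\}$, let $\Theta(\mathcal X,\mathcal Y)=[\theta_1,\dots,\theta_m]$ be the vector of principal angles, $\theta_i\in[0,\pi/2]$, given by $\cos\theta_i=s_i(P_{\mathcal X}P_{\mathcal Y})$, where $s_1\ge s_2\ge\cdots$ are the singular values in nonincreasing order (so that $\theta_1\le\cdots\le\theta_m$); functions of and operations on such vectors are taken entrywise. For real vectors $x,y$ of length $n$ write $x\prec_w y$ if $\sum_{i=1}^k x_i^\downarrow\le\sum_{i=1}^k y_i^\downarrow$ for $k=1,\dots,n$, where $x^\downarrow$ is $x$ rearranged in nonincreasing order; vectors of different lengths are compared after appending zeroes to the shorter one. Let $\mathcal X,\mathcal Y,\mathcal Z$ be subspaces of $\mathcal H$ with $\dim\mathcal X=\dim\mathcal Y$. Then $$|\sin\Theta(\mathcal X,\mathcal Z)-\sin\Theta(\mathcal Y,\mathcal Z)|\prec_w\sin\Theta(\mathcal X,\mathcal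 Y)$$ and $$|\cos\Theta(\mathcal X,\mathcal Z)-\cos\Theta(\mathcal Y,\mathcal Z)|\prec_w\sin\Theta(\mathcal X,\mathcal Y).$$ -/

import Mathlib

/-- The vector of principal angles between the subspaces `X` and `Y`, in nondecreasing order.
It has `min (dim X) (dim Y)` entries, and their cosines are the largest singular values of
`P_X P_Y`, in nonincreasing order (Mathlib indexes singular values from `0`). -/
noncomputable def principalAngles {𝕜 H : Type*} [RCLike 𝕜] [NormedAddCommGroup H]
    [InnerProductSpace 𝕜 H] [FiniteDimensional 𝕜 H] (X Y : Submodule 𝕜 H) :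
    Fin (min (Module.finrank 𝕜 X) (Module.finrank 𝕜 Y)) → ℝ :=
  fun i => Real.arccos
    ((X.starProjection.toLinearMap ∘ₗ Y.starProjection.toLinearMap).singularValues i)

/-- The vector `x` with zeroes appended to length `N` (used with `m ≤ N`). -/
def padZero {m : ℕ} (N : ℕ) (x : Fin m → ℝ) : Fin N → ℝ :=
  fun i => if h : (i : ℕ) < m then x ⟨i, h⟩ else 0

/-- The entries of `x` rearranged in nonincreasing order. -/
noncomputable def decreasingRearrangement {n : ℕ} (x : Fin n → ℝ) : Fin n → ℝ :=
  x ∘ Tuple.sort (fun i => -x i)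

/-- `x ≺_w y`: after appending zeroes to the shorter vector, the sum of the `k` largest entries
of `x` is at most the sum of the `k` largest entries of `y`, for every `k`. -/
def WeaklyMajorizedBy {m n : ℕ} (x : Fin m → ℝ) (y : Fin n → ℝ) : Prop :=
  ∀ k : ℕ, 1 ≤ k → k ≤ max m n →
    ∑ i : Fin (max m n) with i.val < k, decreasingRearrangement (padZero (max m n) x) i ≤
      ∑ i : Fin (max m n) with i.val < k, decreasingRearrangement (padZero (max m n) y) i

infix:50 " ≺ʷ " => WeaklyMajorizedBy

/-! Write p = dim X = dim Y, q = dim Z, n = dim H, and count places from 0. The principal angles of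
X and Z can be read off two spectra: in nonincreasing order, the eigenvalues of P_X - P_Z carry sin
θ_j at place p-1-j and -sin θ_j at place n-q+j, while those of P_X + P_Z carry 1 + cos θ_j at place
j and 1 - cos θ_j at place p+q-1-j, when this place exists. The places depend on dimensions only, so
they are the same for Y and Z.

For e = -1 or e = 1, P_X + e P_Z = (P_Y + e P_Z) + (P_X - P_Y). By Lidskii–Wielandt
(`LinearMap.IsSymmetric.sum_eigenvalues_sub_le`), eigenvalue differences summed over any k places
are at most the sum of the k largest eigenvalues of P_X - P_Y; for k ≤ p these are the k largest
sines between X and Y. Since each angle occurs with both signs, picking for each j the place whose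
sign makes the difference positive produces the absolute values.

Both spectra come from one determinant, `det_sub_starProjection_pair`; counting then places each
eigenvalue in the ordered list. -/

open Module

/-! ### Eigenvalue inequalities for symmetric operators -/

/-- A real diagonal operator in an orthonormal basis. -/
theorem OrthonormalBasis.exists_isSymmetric_diagonal {𝕜 H : Type*} [RCLike 𝕜]
    [NormedAddCommGroup H] [InnerProductSpace 𝕜 H] {n : ℕ} (e : OrthonormalBasis (Fin n) 𝕜 H)
    (d : Fin n → ℝ) : ∃ D : H →ₗ[𝕜] H, D.IsSymmetric ∧
      (∀ v, RCLike.re (inner 𝕜 v (D v)) = ∑ j, d j * ‖e.repr v j‖ ^ 2) ∧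
      RCLike.re (LinearMap.trace 𝕜 H D) = ∑ j, d j := by
  have key : ∀ v w, inner 𝕜 v (Matrix.toLin e.toBasis e.toBasis
      (Matrix.diagonal fun j => (d j : 𝕜)) w) =
        ∑ j, (d j : 𝕜) * (e.repr w j * star (e.repr v j)) := fun v w => by
    have : ∀ j, e.repr (Matrix.toLin e.toBasis e.toBasis
      (Matrix.diagonal fun j => (d j : 𝕜)) w) j = (d j : 𝕜) * e.repr w j := fun j => by
      have := congrFun (Matrix.repr_toLin e.toBasis e.toBasis
        (Matrix.diagonal fun j => (d j : 𝕜)) w) j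
      simpa [Matrix.mulVec_diagonal] using this
    rw [← e.repr.inner_map_map, PiLp.inner_apply]
    refine Finset.sum_congr rfl fun j _ => ?_
    rw [this, RCLike.inner_apply, mul_assoc]; rfl
  refine ⟨Matrix.toLin e.toBasis e.toBasis (Matrix.diagonal fun j => (d j : 𝕜)), ?_, ?_, ?_⟩
  · intro v w
    rw [key, ← inner_conj_symm, key, map_sum]
    refine Finset.sum_congr rfl fun j _ => ?_
    simp [mul_comm]
  · intro v
    rw [key, map_sum]
    refine Finset.sum_congr rfl fun j _ => ?_
    rw [RCLike.star_def, RCLike.mul_conj, RCLike.re_ofReal_mul]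
    norm_cast
  · rw [Matrix.trace_toLin_eq, Matrix.trace_diagonal, map_sum]
    simp

section Spectral

variable {𝕜 H : Type*} [RCLike 𝕜] [NormedAddCommGroup H] [InnerProductSpace 𝕜 H]
  [FiniteDimensional 𝕜 H] {n : ℕ}

/-- The quadratic form of a symmetric operator in the coordinates of its eigenbasis. -/
theorem LinearMap.IsSymmetric.re_inner_apply_eq_sum {A : H →ₗ[𝕜] H} (hA : A.IsSymmetric)
    (hn : finrank 𝕜 H = n) (v : H) :
    RCLike.re (inner 𝕜 v (A v)) =
      ∑ j, hA.eigenvalues hn j * ‖(hA.eigenvectorBasis hn).repr v j‖ ^ 2 := by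
  rw [← (hA.eigenvectorBasis hn).repr.inner_map_map, PiLp.inner_apply, map_sum]
  refine Finset.sum_congr rfl fun j _ => ?_
  rw [hA.eigenvectorBasis_apply_self_apply, RCLike.inner_apply, mul_assoc, RCLike.mul_conj,
    RCLike.re_ofReal_mul]
  norm_cast

/-- Weyl's monotonicity principle: eigenvalues are monotone in the quadratic form. -/
theorem LinearMap.IsSymmetric.eigenvalues_le_add_of_re_inner_le {A B : H →ₗ[𝕜] H}
    (hA : A.IsSymmetric) (hB : B.IsSymmetric) (hn : finrank 𝕜 H = n) (c : ℝ)
    (h : ∀ v, RCLike.re (inner 𝕜 v (A v)) ≤ RCLike.re (inner 𝕜 v (B v)) + c * ‖v‖ ^ 2)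
    (i : Fin n) : hA.eigenvalues hn i ≤ hB.eigenvalues hn i + c := by
  set a := hA.eigenvectorBasis hn with ha
  set b := hB.eigenvectorBasis hn with hb
  -- The kernel of `f` is the span of the top `a`-eigenvectors, up to index i, intersected with the
  -- span of the bottom `b`-eigenvectors, from i on. These are n - 1 conditions: the zero coordinate
  -- at i forbids surjectivity, hence injectivity.
  let f : H →ₗ[𝕜] (Fin n → 𝕜) := LinearMap.pi fun j =>
    if i < j then (LinearMap.proj j) ∘ₗ (WithLp.linearEquiv 2 𝕜 (Fin n → 𝕜)).toLinearMap ∘ₗ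
        a.repr.toLinearEquiv.toLinearMap
    else if j < i then (LinearMap.proj j) ∘ₗ
        (WithLp.linearEquiv 2 𝕜 (Fin n → 𝕜)).toLinearMap ∘ₗ b.repr.toLinearEquiv.toLinearMap
    else 0
  have hfa : ∀ v j, i < j → f v j = a.repr v j := fun v j hj => by simp [f, hj]
  have hfb : ∀ v j, j < i → f v j = b.repr v j := fun v j hj => by simp [f, hj, hj.not_gt]
  have hfi : ∀ v, f v i = 0 := fun v => by simp [f]
  have hns : ¬ Function.Surjective f := fun hs => by
    obtain ⟨v, hv⟩ := hs (Pi.single i 1)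
    have := congrFun hv i
    simp [hfi] at this
  have hni : ¬ Function.Injective f := fun hi =>
    hns ((LinearMap.injective_iff_surjective_of_finrank_eq_finrank (by simp [hn])).1 hi)
  obtain ⟨v, hv, hv0⟩ : ∃ v, f v = 0 ∧ v ≠ 0 := by
    rw [← LinearMap.ker_eq_bot, Submodule.eq_bot_iff] at hni
    push Not at hni
    simpa using hni
  have hpos : 0 < ‖v‖ ^ 2 := by positivity
  have hnorm : ∀ e : OrthonormalBasis (Fin n) 𝕜 H, ‖v‖ ^ 2 = ∑ j, ‖e.repr v j‖ ^ 2 := fun e => by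
    rw [← e.repr.norm_map, EuclideanSpace.norm_sq_eq]
  have h1 : hA.eigenvalues hn i * ‖v‖ ^ 2 ≤ RCLike.re (inner 𝕜 v (A v)) := by
    rw [hA.re_inner_apply_eq_sum hn, hnorm a, Finset.mul_sum]
    refine Finset.sum_le_sum fun j _ => ?_
    rcases lt_or_ge i j with hj | hj
    · have : a.repr v j = 0 := by rw [← hfa v j hj, hv]; rfl
      simp [← ha, this]
    · exact mul_le_mul_of_nonneg_right (hA.eigenvalues_antitone hn hj) (by positivity)
  have h2 : RCLike.re (inner 𝕜 v (B v)) ≤ hB.eigenvalues hn i * ‖v‖ ^ 2 := by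
    rw [hB.re_inner_apply_eq_sum hn, hnorm b, Finset.mul_sum]
    refine Finset.sum_le_sum fun j _ => ?_
    rcases lt_or_ge j i with hj | hj
    · have : b.repr v j = 0 := by rw [← hfb v j hj, hv]; rfl
      simp [← hb, this]
    · exact mul_le_mul_of_nonneg_right (hB.eigenvalues_antitone hn hj) (by positivity)
  have h3 := h v
  refine le_of_mul_le_mul_right ?_ hpos
  linarith

/-- The Lidskii–Wielandt inequality. -/
theorem LinearMap.IsSymmetric.sum_eigenvalues_sub_le {A B C : H →ₗ[𝕜] H}
    (hA : A.IsSymmetric) (hB : B.IsSymmetric) (hC : C.IsSymmetric) (hABC : A = B + C)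
    (hn : finrank 𝕜 H = n) (S : Finset (Fin n)) :
    ∑ i ∈ S, (hA.eigenvalues hn i - hB.eigenvalues hn i) ≤
      ∑ i : Fin n with i.val < S.card, hC.eigenvalues hn i := by
  rcases S.eq_empty_or_nonempty with rfl | hS
  · simp
  have hcard : S.card ≤ n := by simpa using S.card_le_univ
  have hpos := hS.card_pos
  let l : Fin n := ⟨S.card - 1, by omega⟩
  -- With k = `S.card`, μ is the k-th largest eigenvalue of C. The operator D below is the positive
  -- part of C - μ, so C ≤ D + μ and D ≥ 0. Replacing C by D makes every eigenvalue difference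
  -- nonnegative, so the sum over S is at most the full sum, which is the trace of D.
  set μ := hC.eigenvalues hn l with hμ
  obtain ⟨D, hD, hDv, hDt⟩ := (hC.eigenvectorBasis hn).exists_isSymmetric_diagonal
    fun j => max (hC.eigenvalues hn j - μ) 0
  have hBD : (B + D).IsSymmetric := hB.add hD
  have h1 : ∀ i, hA.eigenvalues hn i ≤ hBD.eigenvalues hn i + μ := by
    refine hA.eigenvalues_le_add_of_re_inner_le hBD hn μ fun v => ?_
    have hnorm : ‖v‖ ^ 2 = ∑ j, ‖(hC.eigenvectorBasis hn).repr v j‖ ^ 2 := by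
      rw [← (hC.eigenvectorBasis hn).repr.norm_map, EuclideanSpace.norm_sq_eq]
    have : RCLike.re (inner 𝕜 v (C v)) ≤ RCLike.re (inner 𝕜 v (D v)) + μ * ‖v‖ ^ 2 := by
      rw [hC.re_inner_apply_eq_sum hn, hDv, hnorm, Finset.mul_sum, ← Finset.sum_add_distrib]
      refine Finset.sum_le_sum fun j _ => ?_
      rw [← add_mul]
      refine mul_le_mul_of_nonneg_right ?_ (by positivity)
      linarith [le_max_left (hC.eigenvalues hn j - μ) 0]
    simp only [hABC, LinearMap.add_apply, inner_add_right, map_add]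
    linarith
  have h2 : ∀ i, hB.eigenvalues hn i ≤ hBD.eigenvalues hn i := fun i => by
    have := hB.eigenvalues_le_add_of_re_inner_le hBD hn 0 (fun v => ?_) i
    · simpa using this
    · have : 0 ≤ RCLike.re (inner 𝕜 v (D v)) := by
        rw [hDv]; exact Finset.sum_nonneg fun j _ => by positivity
      simp only [LinearMap.add_apply, inner_add_right, map_add]
      linarith
  have htr : ∑ i, (hBD.eigenvalues hn i - hB.eigenvalues hn i) =
      ∑ j, max (hC.eigenvalues hn j - μ) 0 := by
    rw [← hDt, Finset.sum_sub_distrib, ← hBD.re_trace_eq_sum_eigenvalues,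
      ← hB.re_trace_eq_sum_eigenvalues]
    simp
  -- Only the k largest eigenvalues of C can exceed μ; the k copies of μ subtracted here cancel the
  -- `S.card * μ` paid through `h1`.
  have hmax : ∑ j, max (hC.eigenvalues hn j - μ) 0 =
      ∑ j : Fin n with j.val < S.card, (hC.eigenvalues hn j - μ) := by
    rw [Finset.sum_filter]
    refine Finset.sum_congr rfl fun j _ => ?_
    split_ifs with hj
    · exact max_eq_left (sub_nonneg.2 (hC.eigenvalues_antitone hn
        (Fin.le_def.2 (by simp only [l]; omega))))
    · exact max_eq_right (sub_nonpos.2 (hC.eigenvalues_antitone hn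
        (Fin.le_def.2 (by simp only [l]; omega))))
  have hc : (Finset.univ.filter fun j : Fin n => j.val < S.card).card = S.card := by
    rw [Fin.card_filter_val_lt]; omega
  calc ∑ i ∈ S, (hA.eigenvalues hn i - hB.eigenvalues hn i)
      ≤ ∑ i ∈ S, ((hBD.eigenvalues hn i - hB.eigenvalues hn i) + μ) :=
        Finset.sum_le_sum fun i _ => by linarith [h1 i]
    _ = ∑ i ∈ S, (hBD.eigenvalues hn i - hB.eigenvalues hn i) + S.card * μ := by
        rw [Finset.sum_add_distrib]; simp
    _ ≤ ∑ i, (hBD.eigenvalues hn i - hB.eigenvalues hn i) + S.card * μ := by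
        gcongr
        · exact fun i _ _ => sub_nonneg.2 (h2 i)
        · exact S.subset_univ
    _ = _ := by
        rw [htr, hmax, Finset.sum_sub_distrib]
        simp [hc]

theorem LinearMap.IsSymmetric.det_smul_one_add_smul {A : H →ₗ[𝕜] H} (hA : A.IsSymmetric)
    (hn : finrank 𝕜 H = n) (a b : 𝕜) :
    LinearMap.det (a • (1 : H →ₗ[𝕜] H) + b • A) =
      ∏ i, (a + b * (hA.eigenvalues hn i : 𝕜)) := by
  rw [← LinearMap.det_toMatrix (hA.eigenvectorBasis hn).toBasis, map_add, map_smul, map_smul,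
    hA.toMatrix_eigenvectorBasis, LinearMap.toMatrix_one, ← Matrix.diagonal_one,
    ← Matrix.diagonal_smul, ← Matrix.diagonal_smul, Matrix.diagonal_add, Matrix.det_diagonal]
  simp

theorem LinearMap.det_one_sub_mul_comm (A B : H →ₗ[𝕜] H) :
    LinearMap.det (1 - A * B) = LinearMap.det (1 - B * A) := by
  let b := Module.finBasis 𝕜 H
  simp only [← LinearMap.det_toMatrix b, map_sub, LinearMap.toMatrix_mul, LinearMap.toMatrix_one]
  exact Matrix.det_one_sub_mul_comm _ _

end Spectral

/-! ### The characteristic polynomial of P_X + e P_Z -/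

section ProjectionPair

variable {𝕜 H : Type*} [RCLike 𝕜] [NormedAddCommGroup H] [InnerProductSpace 𝕜 H]
  [FiniteDimensional 𝕜 H] {n : ℕ} (X Z : Submodule 𝕜 H)

/-- The sequence of cosines of the principal angles. -/
noncomputable def angleCosine (i : ℕ) : ℝ :=
  (X.starProjection.toLinearMap ∘ₗ Z.starProjection.toLinearMap).singularValues i

theorem isSymmetric_starProjection_toLinearMap : X.starProjection.toLinearMap.IsSymmetric :=
  X.starProjection_isSymmetric

theorem starProjection_toLinearMap_mul_self :
    X.starProjection.toLinearMap * X.starProjection.toLinearMap = X.starProjection.toLinearMap := by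
  ext v
  exact X.starProjection_eq_self_iff.2 (X.starProjection_apply_mem v)

/-- The determinant of a linear combination of the identity and an orthogonal projection. -/
theorem det_smul_one_add_smul_starProjection (hn : finrank 𝕜 H = n) (a b : 𝕜) :
    a ^ finrank 𝕜 X * LinearMap.det (a • (1 : H →ₗ[𝕜] H) + b • X.starProjection.toLinearMap) =
      a ^ n * (a + b) ^ finrank 𝕜 X := by
  have hX := isSymmetric_starProjection_toLinearMap X
  have heig : ∀ i, hX.eigenvalues hn i = 0 ∨ hX.eigenvalues hn i = 1 := fun i => by
    set v := hX.eigenvectorBasis hn i with hv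
    have h1 := hX.apply_eigenvectorBasis hn i
    have h2 := LinearMap.congr_fun (starProjection_toLinearMap_mul_self X) v
    rw [Module.End.mul_apply, h1, map_smul, h1, ← sub_eq_zero, smul_smul, ← sub_smul] at h2
    have h3 := (smul_eq_zero.1 h2).resolve_right (by
      simpa using (hX.eigenvectorBasis hn).toBasis.ne_zero i)
    have h4 : hX.eigenvalues hn i * (hX.eigenvalues hn i - 1) = 0 := by
      have : ((hX.eigenvalues hn i * (hX.eigenvalues hn i - 1) : ℝ) : 𝕜) = 0 := by
        rw [← h3]; push_cast; ring
      exact_mod_cast this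
    rcases mul_eq_zero.1 h4 with h | h
    · exact Or.inl h
    · exact Or.inr (by linarith)
  have hcard : (Finset.univ.filter fun i => hX.eigenvalues hn i = 1).card = finrank 𝕜 X := by
    have := hX.card_filter_eigenvalues_eq hn (1 : 𝕜)
    have he : Module.End.eigenspace X.starProjection.toLinearMap (1 : 𝕜) = X := by
      ext v
      simp [Submodule.starProjection_eq_self_iff]
    rw [he] at this
    rw [← this]
    congr 1
    ext i
    simp
  have hcard' : (Finset.univ.filter fun i => ¬ hX.eigenvalues hn i = 1).card + finrank 𝕜 X = n := by
    have := Finset.card_filter_add_card_filter_not (s := (Finset.univ : Finset (Fin n)))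
      (fun i => hX.eigenvalues hn i = 1)
    simp only [Finset.card_univ, Fintype.card_fin] at this
    omega
  rw [hX.det_smul_one_add_smul hn, ← Finset.prod_filter_mul_prod_filter_not Finset.univ
    (fun i => hX.eigenvalues hn i = 1),
    Finset.prod_congr (g := fun _ => a + b) rfl (fun i hi => by
      rw [(Finset.mem_filter.1 hi).2]; simp),
    Finset.prod_congr (s₁ := Finset.univ.filter fun i => ¬ hX.eigenvalues hn i = 1)
      (g := fun _ => a) rfl (fun i hi => by
      rw [(heig i).resolve_right (Finset.mem_filter.1 hi).2]; simp),
    Finset.prod_const, Finset.prod_const, hcard]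
  conv_rhs => rw [← hcard', pow_add]
  ring

theorem adjoint_starProjection_comp :
    LinearMap.adjoint (X.starProjection.toLinearMap ∘ₗ Z.starProjection.toLinearMap) =
      Z.starProjection.toLinearMap ∘ₗ X.starProjection.toLinearMap := by
  rw [LinearMap.adjoint_comp]
  congr 1
  · exact (LinearMap.isSymmetric_iff_isSelfAdjoint _).1 (isSymmetric_starProjection_toLinearMap Z)
  · exact (LinearMap.isSymmetric_iff_isSelfAdjoint _).1 (isSymmetric_starProjection_toLinearMap X)

theorem angleCosine_nonneg (i : ℕ) : 0 ≤ angleCosine X Z i :=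
  LinearMap.singularValues_nonneg _ _

theorem angleCosine_antitone : Antitone (angleCosine X Z) :=
  LinearMap.singularValues_antitone _

/-- A singular value of T is ‖T v‖ for a unit eigenvector v of T*T, and projections do not lengthen
vectors. -/
theorem angleCosine_le_one (i : ℕ) : angleCosine X Z i ≤ 1 := by
  set T := X.starProjection.toLinearMap ∘ₗ Z.starProjection.toLinearMap with hT
  rcases lt_or_ge i (finrank 𝕜 H) with hi | hi
  · have hsq := T.sq_singularValues_of_lt rfl hi
    set hS := T.isSymmetric_adjoint_comp_self
    set v := hS.eigenvectorBasis rfl ⟨i, hi⟩ with hv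
    have hv1 : ‖v‖ = 1 := (hS.eigenvectorBasis rfl).orthonormal.1 _
    have h1 : ‖T v‖ ^ 2 = hS.eigenvalues rfl ⟨i, hi⟩ := by
      have h2 : inner 𝕜 v ((LinearMap.adjoint T ∘ₗ T) v) = inner 𝕜 (T v) (T v) := by
        rw [LinearMap.comp_apply, LinearMap.adjoint_inner_right]
      rw [hS.apply_eigenvectorBasis, inner_smul_right, inner_self_eq_norm_sq_to_K, hv1,
        inner_self_eq_norm_sq_to_K] at h2
      have h3 : ((hS.eigenvalues rfl ⟨i, hi⟩ : ℝ) : 𝕜) = ((‖T v‖ ^ 2 : ℝ) : 𝕜) := by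
        simpa using h2
      exact_mod_cast h3.symm
    have h4 : ‖T v‖ ≤ 1 := by
      calc ‖T v‖ = ‖X.starProjection (Z.starProjection v)‖ := rfl
        _ ≤ ‖Z.starProjection v‖ := X.norm_starProjection_apply_le _
        _ ≤ ‖v‖ := Z.norm_starProjection_apply_le _
        _ = 1 := hv1
    have h5 : angleCosine X Z i ^ 2 = ‖T v‖ ^ 2 := by rw [h1]; exact hsq
    nlinarith [norm_nonneg (T v), angleCosine_nonneg X Z i]
  · rw [angleCosine, LinearMap.singularValues_of_finrank_le _ hi]; exact zero_le_one

theorem angleCosine_eq_zero {i : ℕ} (hi : min (finrank 𝕜 X) (finrank 𝕜 Z) ≤ i) :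
    angleCosine X Z i = 0 := by
  rw [angleCosine, LinearMap.singularValues_eq_zero_iff_le_finrank_range]
  refine le_trans (le_min ?_ ?_) hi
  · refine Submodule.finrank_mono ?_
    rintro _ ⟨v, rfl⟩
    exact X.starProjection_apply_mem _
  · rw [LinearMap.range_comp]
    refine (Submodule.finrank_map_le _ _).trans (Submodule.finrank_mono ?_)
    rintro _ ⟨v, rfl⟩
    exact Z.starProjection_apply_mem _

/-- For T = P_X P_Z the triple product is T*T, whose eigenvalues are the squared cosines; past the
number of angles they vanish and contribute factors 1. -/
theorem det_one_sub_smul_projection_triple (hn : finrank 𝕜 H = n) (c : 𝕜) :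
    LinearMap.det (1 - c • (Z.starProjection.toLinearMap * X.starProjection.toLinearMap *
      Z.starProjection.toLinearMap)) =
      ∏ i ∈ Finset.range (min (finrank 𝕜 X) (finrank 𝕜 Z)),
        (1 - c * ((angleCosine X Z i ^ 2 : ℝ) : 𝕜)) := by
  set T := X.starProjection.toLinearMap ∘ₗ Z.starProjection.toLinearMap with hT
  have hK : Z.starProjection.toLinearMap * X.starProjection.toLinearMap *
      Z.starProjection.toLinearMap = LinearMap.adjoint T ∘ₗ T := by
    rw [hT, adjoint_starProjection_comp]
    change _ = _ * X.starProjection.toLinearMap * (X.starProjection.toLinearMap * _)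
    rw [mul_assoc, mul_assoc, ← mul_assoc X.starProjection.toLinearMap X.starProjection.toLinearMap,
      starProjection_toLinearMap_mul_self]
  have h1 := T.isSymmetric_adjoint_comp_self.det_smul_one_add_smul hn 1 (-c)
  rw [one_smul, neg_smul, ← sub_eq_add_neg] at h1
  have hm : min (finrank 𝕜 X) (finrank 𝕜 Z) ≤ n :=
    (min_le_left _ _).trans (hn ▸ X.finrank_le)
  rw [hK, h1, Finset.prod_subset (Finset.range_subset_range.2 hm), Finset.prod_range]
  · refine Finset.prod_congr rfl fun i _ => ?_
    rw [← T.sq_singularValues_fin hn]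
    simp [angleCosine, hT, sub_eq_add_neg]
  · intro i _ hi
    rw [angleCosine_eq_zero X Z (not_lt.1 fun h => hi (Finset.mem_range.2 h))]
    simp

theorem isSymmetric_starProjection_add_smul (e : ℝ) :
    (X.starProjection.toLinearMap + (e : 𝕜) • Z.starProjection.toLinearMap).IsSymmetric :=
  (isSymmetric_starProjection_toLinearMap X).add
    ((isSymmetric_starProjection_toLinearMap Z).smul (by simp))

/-- With P = P_X and Q = P_Z, factor out u - P, and use det(1 - AB) = det(1 - BA) to compress the
remaining factor to Q. Only QPQ then mixes the two projections. Powers of u stay on the left so that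
no exponent is a difference of dimensions. -/
theorem det_sub_starProjection_pair (hn : finrank 𝕜 H = n) {u e : 𝕜} (hu : u ≠ 0) (hu1 : u ≠ 1)
    (hue : u ≠ e) :
    u ^ finrank 𝕜 X * u ^ finrank 𝕜 Z * LinearMap.det (u • (1 : H →ₗ[𝕜] H) -
      (X.starProjection.toLinearMap + e • Z.starProjection.toLinearMap)) =
      u ^ n * (u - 1) ^ finrank 𝕜 X * (u - e) ^ finrank 𝕜 Z *
      ∏ i ∈ Finset.range (min (finrank 𝕜 X) (finrank 𝕜 Z)),
        (1 - e / ((u - 1) * (u - e)) * ((angleCosine X Z i ^ 2 : ℝ) : 𝕜)) := by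
  have hu1' : u - 1 ≠ 0 := sub_ne_zero.2 hu1
  have hue' : u - e ≠ 0 := sub_ne_zero.2 hue
  rw [← det_one_sub_smul_projection_triple X Z hn]
  have hdX := det_smul_one_add_smul_starProjection X hn u (-1)
  have hdZ := det_smul_one_add_smul_starProjection Z hn u (-e)
  have hPP := starProjection_toLinearMap_mul_self X
  have hQQ := starProjection_toLinearMap_mul_self Z
  generalize X.starProjection.toLinearMap = P at *
  generalize Z.starProjection.toLinearMap = Q at *
  -- The resolvent (u - P)⁻¹, explicit because P is idempotent.
  let R : H →ₗ[𝕜] H := u⁻¹ • (1 + (u - 1)⁻¹ • P)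
  have h1 : u • (1 : H →ₗ[𝕜] H) - (P + e • Q) =
      (u • (1 : H →ₗ[𝕜] H) + (-1 : 𝕜) • P) * (1 - (e • (R * Q)) * Q) := by
    have : (u • (1 : H →ₗ[𝕜] H) + (-1 : 𝕜) • P) * R = 1 := by
      simp only [R, mul_add, add_mul, smul_mul_assoc, mul_smul_comm, one_mul, mul_one, hPP]
      match_scalars <;> field_simp <;> ring
    rw [mul_sub, smul_mul_assoc, mul_assoc R, hQQ, mul_smul_comm, ← mul_assoc, this]
    simp only [one_mul, mul_one]
    module
  -- Since Q fixes QPQ, (u - eQ) QPQ = (u - e) QPQ; this produces the denominator u - e.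
  have h2 : u • (1 - Q * (e • (R * Q))) =
      (u • (1 : H →ₗ[𝕜] H) + (-e) • Q) * (1 - (e / ((u - 1) * (u - e))) • (Q * P * Q)) := by
    have h3 : Q * (Q * (P * Q)) = Q * (P * Q) := by rw [← mul_assoc, hQQ]
    simp only [R, mul_add, add_mul, mul_sub, smul_mul_assoc, mul_smul_comm, one_mul, mul_one, hQQ,
      mul_assoc, h3]
    match_scalars <;> field_simp <;> ring
  have h4 := congrArg LinearMap.det h2
  rw [LinearMap.det_smul, hn, map_mul] at h4
  have hun : u ^ n ≠ 0 := pow_ne_zero _ hu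
  rw [h1, map_mul, LinearMap.det_one_sub_mul_comm]
  refine mul_left_cancel₀ hun ?_
  calc _ = (u ^ finrank 𝕜 X * LinearMap.det (u • (1 : H →ₗ[𝕜] H) + (-1 : 𝕜) • P)) *
        u ^ finrank 𝕜 Z * (u ^ n * LinearMap.det (1 - Q * (e • (R * Q)))) := by ring
    _ = _ := by
      rw [h4, hdX]
      calc _ = u ^ n * (u + -1) ^ finrank 𝕜 X * (u ^ finrank 𝕜 Z *
            LinearMap.det (u • (1 : H →ₗ[𝕜] H) + (-e) • Q)) *
            LinearMap.det (1 - (e / ((u - 1) * (u - e))) • (Q * P * Q)) := by ring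
        _ = _ := by rw [hdZ]; ring

/-- The spectrum of `P_X + e P_Z` in terms of the principal angles, evaluated away from
`0`, `1`, `e`. -/
theorem prod_sub_eigenvalues_starProjection_pair (hn : finrank 𝕜 H = n) {u e : ℝ} (hu : u ≠ 0)
    (hu1 : u ≠ 1) (hue : u ≠ e) :
    u ^ finrank 𝕜 X * u ^ finrank 𝕜 Z *
        (∏ i, (u - (isSymmetric_starProjection_add_smul X Z e).eigenvalues hn i)) *
        ((u - 1) * (u - e)) ^ min (finrank 𝕜 X) (finrank 𝕜 Z) =
      u ^ n * (u - 1) ^ finrank 𝕜 X * (u - e) ^ finrank 𝕜 Z *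
      ∏ i : Fin (min (finrank 𝕜 X) (finrank 𝕜 Z)),
        ((u - 1) * (u - e) - e * angleCosine X Z i ^ 2) := by
  have hu1' : u - 1 ≠ 0 := sub_ne_zero.2 hu1
  have hue' : u - e ≠ 0 := sub_ne_zero.2 hue
  have h := det_sub_starProjection_pair X Z hn (u := (u : 𝕜)) (e := (e : 𝕜))
    (by exact_mod_cast hu) (by exact_mod_cast hu1) (by exact_mod_cast hue)
  have h2 := (isSymmetric_starProjection_add_smul X Z e).det_smul_one_add_smul hn (u : 𝕜) (-1)
  rw [neg_one_smul, ← sub_eq_add_neg] at h2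
  rw [h2] at h
  have h3 : u ^ finrank 𝕜 X * u ^ finrank 𝕜 Z *
        (∏ i, (u - (isSymmetric_starProjection_add_smul X Z e).eigenvalues hn i)) =
      u ^ n * (u - 1) ^ finrank 𝕜 X * (u - e) ^ finrank 𝕜 Z *
      ∏ i ∈ Finset.range (min (finrank 𝕜 X) (finrank 𝕜 Z)),
        (1 - e / ((u - 1) * (u - e)) * angleCosine X Z i ^ 2) := by
    apply RCLike.ofReal_injective (K := 𝕜)
    push_cast
    simpa [sub_eq_add_neg] using h
  rw [h3, mul_assoc, Finset.prod_range]
  congr 1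
  rw [← Fin.prod_const, ← Finset.prod_mul_distrib]
  refine Finset.prod_congr rfl fun i _ => ?_
  field_simp

end ProjectionPair

/-! ### Multisets of eigenvalues and counting -/

/-- Two polynomials that agree off a finite set are equal, and so have the same roots. -/
theorem Multiset.eq_of_prod_map_sub_eq {M N : Multiset ℝ} (F : Set ℝ) (hF : F.Finite)
    (h : ∀ u ∉ F, (M.map fun a => u - a).prod = (N.map fun a => u - a).prod) : M = N := by
  have key : (M.map fun a => Polynomial.X - Polynomial.C a).prod =
      (N.map fun a => Polynomial.X - Polynomial.C a).prod := by
    refine Polynomial.eq_of_infinite_eval_eq _ _ (hF.infinite_compl.mono fun u hu => ?_)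
    simpa [Polynomial.eval_multiset_prod, Multiset.map_map] using h u hu
  rw [← Polynomial.roots_multiset_prod_X_sub_C M, key, Polynomial.roots_multiset_prod_X_sub_C]

section Order

variable {n : ℕ} {f : Fin n → ℝ}

theorem Antitone.le_of_card_filter_lt_le (hf : Antitone f) {x : ℝ} {i : Fin n}
    (h : (Finset.univ.filter fun l => x < f l).card ≤ i) : f i ≤ x := by
  by_contra! hx
  have : Finset.Iic i ⊆ Finset.univ.filter fun l => x < f l := fun l hl => by
    simpa using hx.trans_le (hf (Finset.mem_Iic.1 hl))
  have := Finset.card_le_card this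
  rw [Fin.card_Iic] at this
  omega

theorem Antitone.le_of_lt_card_filter_le (hf : Antitone f) {x : ℝ} {i : Fin n}
    (h : i < (Finset.univ.filter fun l => x ≤ f l).card) : x ≤ f i := by
  by_contra! hx
  have : (Finset.univ.filter fun l => x ≤ f l) ⊆ Finset.Iio i := fun l hl => by
    simp only [Finset.mem_filter, Finset.mem_univ, true_and] at hl
    rw [Finset.mem_Iio]
    by_contra! hil
    exact (hl.trans (hf hil)).not_gt hx
  have := Finset.card_le_card this
  rw [Fin.card_Iio] at this
  omega

end Order

section Counting

variable {n p q m : ℕ}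

theorem Multiset.countP_replicate_eq_ite {β : Type*} (P : β → Prop) [DecidablePred P] (k : ℕ)
    (a : β) : (Multiset.replicate k a).countP P = if P a then k else 0 := by
  rw [← Multiset.coe_replicate, Multiset.coe_countP, List.countP_replicate]
  simp

theorem countP_map_univ (f : Fin m → ℝ) (P : ℝ → Prop) [DecidablePred P] :
    (Finset.univ.val.map f).countP P = (Finset.univ.filter fun i => P (f i)).card := by
  rw [Multiset.countP_map]; rfl

/-- Counting form of the spectrum of a difference of two orthogonal projections. -/
theorem count_of_difference_spectrum {α : Fin n → ℝ} {s : Fin m → ℝ}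
    (h : Finset.univ.val.map α + Multiset.replicate (p + q) 0 + Multiset.replicate m 1 +
      Multiset.replicate m (-1) = Multiset.replicate n 0 + Multiset.replicate p 1 +
      Multiset.replicate q (-1) + Finset.univ.val.map s + Finset.univ.val.map (fun i => -s i))
    (P : ℝ → Prop) [DecidablePred P] :
    (Finset.univ.filter fun i => P (α i)).card + (if P 0 then p + q else 0) +
      (if P 1 then m else 0) + (if P (-1) then m else 0) =
      (if P 0 then n else 0) + (if P 1 then p else 0) + (if P (-1) then q else 0) +
      (Finset.univ.filter fun i => P (s i)).card + (Finset.univ.filter fun i => P (-s i)).card := by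
  have := congrArg (Multiset.countP P) h
  simpa only [Multiset.countP_add, countP_map_univ, Multiset.countP_replicate_eq_ite] using this

theorem count_of_sum_spectrum {α : Fin n → ℝ} {s : Fin m → ℝ}
    (h : Finset.univ.val.map α + Multiset.replicate (p + q) 0 + Multiset.replicate (2 * m) 1 =
      Multiset.replicate n 0 + Multiset.replicate (p + q) 1 +
      Finset.univ.val.map (fun i => 1 + s i) + Finset.univ.val.map (fun i => 1 - s i))
    (P : ℝ → Prop) [DecidablePred P] :
    (Finset.univ.filter fun i => P (α i)).card + (if P 0 then p + q else 0) +
      (if P 1 then 2 * m else 0) = (if P 0 then n else 0) + (if P 1 then p + q else 0) +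
      (Finset.univ.filter fun i => P (1 + s i)).card +
      (Finset.univ.filter fun i => P (1 - s i)).card := by
  have := congrArg (Multiset.countP P) h
  simpa only [Multiset.countP_add, countP_map_univ, Multiset.countP_replicate_eq_ite] using this

end Counting

/-! ### The spectra of P_X - P_Z and P_X + P_Z -/

section ProjectionPair

variable {𝕜 H : Type*} [RCLike 𝕜] [NormedAddCommGroup H] [InnerProductSpace 𝕜 H]
  [FiniteDimensional 𝕜 H] {n : ℕ} (X Z : Submodule 𝕜 H)

/-- The sequence of sines of the principal angles. -/
noncomputable def angleSine (i : ℕ) : ℝ := √(1 - angleCosine X Z i ^ 2)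

theorem angleSine_nonneg (i : ℕ) : 0 ≤ angleSine X Z i := Real.sqrt_nonneg _

theorem sq_angleSine (i : ℕ) : angleSine X Z i ^ 2 = 1 - angleCosine X Z i ^ 2 :=
  Real.sq_sqrt (by nlinarith [angleCosine_nonneg X Z i, angleCosine_le_one X Z i])

theorem angleSine_le_one (i : ℕ) : angleSine X Z i ≤ 1 := by
  nlinarith [sq_angleSine X Z i, angleSine_nonneg X Z i, sq_nonneg (angleCosine X Z i)]

theorem angleSine_monotone : Monotone (angleSine X Z) := fun i j hij =>
  Real.sqrt_le_sqrt (by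
    nlinarith [angleCosine_antitone X Z hij, angleCosine_nonneg X Z i, angleCosine_nonneg X Z j])

/-- The spectrum of `P_X - P_Z`. -/
theorem difference_spectrum (hn : finrank 𝕜 H = n) :
    Finset.univ.val.map ((isSymmetric_starProjection_add_smul X Z (-1)).eigenvalues hn) +
      Multiset.replicate (finrank 𝕜 X + finrank 𝕜 Z) 0 +
      Multiset.replicate (min (finrank 𝕜 X) (finrank 𝕜 Z)) 1 +
      Multiset.replicate (min (finrank 𝕜 X) (finrank 𝕜 Z)) (-1) =
    Multiset.replicate n 0 + Multiset.replicate (finrank 𝕜 X) 1 +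
      Multiset.replicate (finrank 𝕜 Z) (-1) +
      Finset.univ.val.map
        (fun i : Fin (min (finrank 𝕜 X) (finrank 𝕜 Z)) => angleSine X Z i) +
      Finset.univ.val.map
        (fun i : Fin (min (finrank 𝕜 X) (finrank 𝕜 Z)) => -angleSine X Z i) := by
  -- The excluded points are 0, 1 and e = -1, where the determinant formula is not available.
  -- Multiplicities such as n - p - q may be negative, so they are moved across the equality as
  -- padding on both sides.
  refine Multiset.eq_of_prod_map_sub_eq {0, 1, -1} (by simp) fun u hu => ?_
  simp only [Set.mem_insert_iff, Set.mem_singleton_iff, not_or] at hu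
  have h := prod_sub_eigenvalues_starProjection_pair X Z hn hu.1 hu.2.1 hu.2.2
  have h2 : ∏ i : Fin (min (finrank 𝕜 X) (finrank 𝕜 Z)),
        ((u - 1) * (u - -1) - -1 * angleCosine X Z i ^ 2) =
      (∏ i : Fin (min (finrank 𝕜 X) (finrank 𝕜 Z)), (u - angleSine X Z i)) *
      ∏ i : Fin (min (finrank 𝕜 X) (finrank 𝕜 Z)), (u - -angleSine X Z i) := by
    rw [← Finset.prod_mul_distrib]
    refine Finset.prod_congr rfl fun i _ => ?_
    linear_combination sq_angleSine X Z i
  rw [h2] at h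
  simp only [Multiset.map_add, Multiset.prod_add, Multiset.map_replicate, Multiset.prod_replicate,
    Multiset.map_map, Function.comp_def]
  simp only [Finset.prod] at h ⊢
  rw [mul_pow] at h
  rw [sub_zero, pow_add]
  linear_combination h

/-- The spectrum of `P_X + P_Z`. -/
theorem sum_spectrum (hn : finrank 𝕜 H = n) :
    Finset.univ.val.map ((isSymmetric_starProjection_add_smul X Z 1).eigenvalues hn) +
      Multiset.replicate (finrank 𝕜 X + finrank 𝕜 Z) 0 +
      Multiset.replicate (2 * min (finrank 𝕜 X) (finrank 𝕜 Z)) 1 =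
    Multiset.replicate n 0 + Multiset.replicate (finrank 𝕜 X + finrank 𝕜 Z) 1 +
      Finset.univ.val.map
        (fun i : Fin (min (finrank 𝕜 X) (finrank 𝕜 Z)) => 1 + angleCosine X Z i) +
      Finset.univ.val.map
        (fun i : Fin (min (finrank 𝕜 X) (finrank 𝕜 Z)) => 1 - angleCosine X Z i) := by
  refine Multiset.eq_of_prod_map_sub_eq {0, 1} (by simp) fun u hu => ?_
  simp only [Set.mem_insert_iff, Set.mem_singleton_iff, not_or] at hu
  have h := prod_sub_eigenvalues_starProjection_pair X Z hn hu.1 hu.2 hu.2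
  have h2 : ∏ i : Fin (min (finrank 𝕜 X) (finrank 𝕜 Z)),
        ((u - 1) * (u - 1) - 1 * angleCosine X Z i ^ 2) =
      (∏ i : Fin (min (finrank 𝕜 X) (finrank 𝕜 Z)), (u - (1 + angleCosine X Z i))) *
      ∏ i : Fin (min (finrank 𝕜 X) (finrank 𝕜 Z)), (u - (1 - angleCosine X Z i)) := by
    rw [← Finset.prod_mul_distrib]
    exact Finset.prod_congr rfl fun i _ => by ring
  rw [h2] at h
  simp only [Multiset.map_add, Multiset.prod_add, Multiset.map_replicate, Multiset.prod_replicate,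
    Multiset.map_map, Function.comp_def]
  simp only [Finset.prod] at h ⊢
  rw [mul_pow] at h
  rw [sub_zero, pow_add, pow_add, two_mul, pow_add]
  linear_combination h

end ProjectionPair

/-! ### Locating each eigenvalue in the ordered list -/

section Monotone

variable {m : ℕ} {s : Fin m → ℝ}

theorem Monotone.lt_card_filter_le (hs : Monotone s) (j : Fin m) :
    j.val < (Finset.univ.filter fun i => s i ≤ s j).card := by
  have : Finset.Iic j ⊆ Finset.univ.filter fun i => s i ≤ s j := fun l hl => by
    simpa using hs (Finset.mem_Iic.1 hl)
  have := Finset.card_le_card this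
  rw [Fin.card_Iic] at this
  omega

theorem Monotone.card_filter_lt_le (hs : Monotone s) (j : Fin m) :
    (Finset.univ.filter fun i => s i < s j).card ≤ j := by
  have : (Finset.univ.filter fun i => s i < s j) ⊆ Finset.Iio j := fun l hl => by
    simp only [Finset.mem_filter, Finset.mem_univ, true_and] at hl
    exact Finset.mem_Iio.2 (hs.reflect_lt hl)
  have := Finset.card_le_card this
  rwa [Fin.card_Iio] at this

theorem Monotone.le_card_filter_ge (hs : Monotone s) (j : Fin m) :
    m ≤ (Finset.univ.filter fun i => s j ≤ s i).card + j := by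
  have h := Finset.card_filter_add_card_filter_not (s := (Finset.univ : Finset (Fin m)))
    (fun i => s i < s j)
  simp only [not_lt, Finset.card_univ, Fintype.card_fin] at h
  have := hs.card_filter_lt_le j
  omega

theorem Monotone.card_filter_gt_lt (hs : Monotone s) (j : Fin m) :
    (Finset.univ.filter fun i => s j < s i).card + j < m := by
  have h := Finset.card_filter_add_card_filter_not (s := (Finset.univ : Finset (Fin m)))
    (fun i => s i ≤ s j)
  simp only [not_le, Finset.card_univ, Fintype.card_fin] at h
  have := hs.lt_card_filter_le j
  omega

theorem card_filter_of_forall {P : Fin m → Prop} [DecidablePred P] (h : ∀ i, P i) :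
    (Finset.univ.filter P).card = m := by
  simp [h]

theorem card_filter_of_forall_not {P : Fin m → Prop} [DecidablePred P] (h : ∀ i, ¬ P i) :
    (Finset.univ.filter P).card = 0 := by
  simp [h]

end Monotone

section Spectrum

variable {n p q m : ℕ} {α : Fin n → ℝ} {s : Fin m → ℝ}

/-- The ordered list starts with p - m ones followed by the `s j` from largest to smallest, filling
p places. The hypothesis `hz` matters only when `s j = 0`: it guarantees at least p nonnegative
eigenvalues even if p + q > n. -/
theorem difference_spectrum_apply_pos (hα : Antitone α) (hs : Monotone s) (h0 : ∀ i, 0 ≤ s i)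
    (h1 : ∀ i, s i ≤ 1) (hmp : m ≤ p)
    (h : Finset.univ.val.map α + Multiset.replicate (p + q) 0 + Multiset.replicate m 1 +
      Multiset.replicate m (-1) = Multiset.replicate n 0 + Multiset.replicate p 1 +
      Multiset.replicate q (-1) + Finset.univ.val.map s + Finset.univ.val.map (fun i => -s i))
    (hz : p + q ≤ n + (Finset.univ.filter fun i => s i = 0).card) {i : Fin n} {j : Fin m}
    (hij : i.val + 1 + j = p) : α i = s j := by
  have hj0 := h0 j
  have hj1 := h1 j
  apply le_antisymm
  · apply hα.le_of_card_filter_lt_le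
    have c := count_of_difference_spectrum h (fun y => s j < y)
    have c1 := hs.card_filter_gt_lt j
    have c2 : (Finset.univ.filter fun i => s j < -s i).card = 0 :=
      card_filter_of_forall_not fun i => by linarith [h0 i]
    split_ifs at c <;> first | (exfalso; linarith) | omega
  · apply hα.le_of_lt_card_filter_le
    have c := count_of_difference_spectrum h (fun y => s j ≤ y)
    have c1 := hs.le_card_filter_ge j
    rcases hj0.eq_or_lt with hj | hj
    · have c2 : (Finset.univ.filter fun i => s j ≤ -s i) = Finset.univ.filter fun i => s i = 0 := by
        refine Finset.filter_congr fun i _ => ⟨fun h => ?_, fun h => ?_⟩ <;> linarith [h0 i]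
      have c3 : (Finset.univ.filter fun i => s j ≤ s i).card = m :=
        card_filter_of_forall fun i => by linarith [h0 i]
      rw [c2, c3] at c
      split_ifs at c <;> first | (exfalso; linarith) | omega
    · split_ifs at c <;> first | (exfalso; linarith) | omega

/-- The last q places hold the `-s j`, starting with the smallest `s j`, and then q - m copies of
-1. -/
theorem difference_spectrum_apply_neg (hα : Antitone α) (hs : Monotone s) (h0 : ∀ i, 0 ≤ s i)
    (h1 : ∀ i, s i ≤ 1)
    (h : Finset.univ.val.map α + Multiset.replicate (p + q) 0 + Multiset.replicate m 1 +
      Multiset.replicate m (-1) = Multiset.replicate n 0 + Multiset.replicate p 1 +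
      Multiset.replicate q (-1) + Finset.univ.val.map s + Finset.univ.val.map (fun i => -s i))
    (hz : p + q ≤ n + (Finset.univ.filter fun i => s i = 0).card) {i : Fin n} {j : Fin m}
    (hij : i.val + q = n + j) : α i = -s j := by
  have hj0 := h0 j
  have hj1 := h1 j
  apply le_antisymm
  · apply hα.le_of_card_filter_lt_le
    have c := count_of_difference_spectrum h (fun y => -s j < y)
    rcases hj0.eq_or_lt with hj | hj
    · have c2 : (Finset.univ.filter fun i => -s j < -s i).card = 0 :=
        card_filter_of_forall_not fun i => by linarith [h0 i]
      have c3 : (Finset.univ.filter fun i => -s j < s i) =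
          Finset.univ.filter fun i => ¬ s i = 0 := by
        refine Finset.filter_congr fun i _ => ⟨fun h h' => by linarith, fun h => ?_⟩
        linarith [lt_of_le_of_ne (h0 i) (Ne.symm h)]
      have c4 := Finset.card_filter_add_card_filter_not (s := (Finset.univ : Finset (Fin m)))
        (fun i => s i = 0)
      rw [Finset.card_univ, Fintype.card_fin] at c4
      rw [c2, c3] at c
      split_ifs at c <;> first | (exfalso; linarith) | omega
    · have c1 := hs.card_filter_lt_le j
      have c2 : (Finset.univ.filter fun i => -s j < s i).card = m :=
        card_filter_of_forall fun i => by linarith [h0 i]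
      simp only [neg_lt_neg_iff] at c
      split_ifs at c <;> first | (exfalso; linarith) | omega
  · apply hα.le_of_lt_card_filter_le
    have c := count_of_difference_spectrum h (fun y => -s j ≤ y)
    have c1 := hs.lt_card_filter_le j
    have c2 : (Finset.univ.filter fun i => -s j ≤ s i).card = m :=
      card_filter_of_forall fun i => by linarith [h0 i]
    by_cases hj : s j = 1
    · have c3 : (Finset.univ.filter fun i => -s j ≤ -s i).card = m :=
        card_filter_of_forall fun i => by linarith [h1 i]
      split_ifs at c <;> first | (exfalso; linarith) | omega
    · have hj := lt_of_le_of_ne hj1 hj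
      simp only [neg_le_neg_iff] at c
      split_ifs at c <;> first | (exfalso; linarith) | omega

theorem sum_spectrum_apply_pos (hα : Antitone α) (hs : Antitone s) (h0 : ∀ i, 0 ≤ s i)
    (hmp : m ≤ p) (hmq : m ≤ q)
    (h : Finset.univ.val.map α + Multiset.replicate (p + q) 0 + Multiset.replicate (2 * m) 1 =
      Multiset.replicate n 0 + Multiset.replicate (p + q) 1 +
      Finset.univ.val.map (fun i => 1 + s i) + Finset.univ.val.map (fun i => 1 - s i))
    {i : Fin n} {j : Fin m} (hij : i.val = j) : α i = 1 + s j := by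
  have hj0 := h0 j
  have hs' : Monotone fun i => -s i := hs.neg
  apply le_antisymm
  · apply hα.le_of_card_filter_lt_le
    have c := count_of_sum_spectrum h (fun y => 1 + s j < y)
    have c1 := hs'.card_filter_lt_le j
    simp only [neg_lt_neg_iff] at c1
    have c2 : (Finset.univ.filter fun i => 1 + s j < 1 - s i).card = 0 :=
      card_filter_of_forall_not fun i => by linarith [h0 i]
    simp only [add_lt_add_iff_left] at c
    split_ifs at c <;> first | (exfalso; linarith) | omega
  · apply hα.le_of_lt_card_filter_le
    have c := count_of_sum_spectrum h (fun y => 1 + s j ≤ y)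
    have c1 := hs'.lt_card_filter_le j
    simp only [neg_le_neg_iff] at c1
    simp only [add_le_add_iff_left] at c
    rcases hj0.eq_or_lt with hj | hj
    · have c3 : (Finset.univ.filter fun i => s j ≤ s i).card = m :=
        card_filter_of_forall fun i => by linarith [h0 i]
      have c2 : 0 < (Finset.univ.filter fun i => 1 + s j ≤ 1 - s i).card :=
        Finset.card_pos.2 ⟨j, by simp; linarith⟩
      split_ifs at c <;> first | (exfalso; linarith) | omega
    · split_ifs at c <;> first | (exfalso; linarith) | omega

theorem sum_spectrum_apply_neg (hα : Antitone α) (hs : Antitone s) (h0 : ∀ i, 0 ≤ s i)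
    (h1 : ∀ i, s i ≤ 1) (hmp : m ≤ p) (hmq : m ≤ q)
    (h : Finset.univ.val.map α + Multiset.replicate (p + q) 0 + Multiset.replicate (2 * m) 1 =
      Multiset.replicate n 0 + Multiset.replicate (p + q) 1 +
      Finset.univ.val.map (fun i => 1 + s i) + Finset.univ.val.map (fun i => 1 - s i))
    {i : Fin n} {j : Fin m} (hij : i.val + 1 + j = p + q) : α i = 1 - s j := by
  have hj0 := h0 j
  have hj1 := h1 j
  have hs' : Monotone fun i => -s i := hs.neg
  apply le_antisymm
  · apply hα.le_of_card_filter_lt_le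
    have c := count_of_sum_spectrum h (fun y => 1 - s j < y)
    rcases hj0.eq_or_lt with hj | hj
    · have c2 : (Finset.univ.filter fun i => 1 - s j < 1 - s i).card = 0 :=
        card_filter_of_forall_not fun i => by linarith [h0 i]
      have c3 : (Finset.univ.filter fun i => 1 - s j < 1 + s i).card ≤ m := by
        simpa using Finset.card_le_univ (Finset.univ.filter fun i => 1 - s j < 1 + s i)
      split_ifs at c <;> first | (exfalso; linarith) | omega
    · have c1 := hs'.card_filter_gt_lt j
      simp only [neg_lt_neg_iff] at c1
      simp only [sub_lt_sub_iff_left] at c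
      have c2 : (Finset.univ.filter fun i => 1 - s j < 1 + s i).card = m :=
        card_filter_of_forall fun i => by linarith [h0 i]
      split_ifs at c <;> first | (exfalso; linarith) | omega
  · apply hα.le_of_lt_card_filter_le
    have c := count_of_sum_spectrum h (fun y => 1 - s j ≤ y)
    have c2 : (Finset.univ.filter fun i => 1 - s j ≤ 1 + s i).card = m :=
      card_filter_of_forall fun i => by linarith [h0 i]
    by_cases hj : s j = 1
    · have c3 : (Finset.univ.filter fun i => 1 - s j ≤ 1 - s i).card = m :=
        card_filter_of_forall fun i => by linarith [h1 i]
      have := i.isLt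
      split_ifs at c <;> first | (exfalso; linarith) | omega
    · have hj := lt_of_le_of_ne hj1 hj
      have c1 := hs'.le_card_filter_ge j
      simp only [neg_le_neg_iff] at c1
      simp only [sub_le_sub_iff_left] at c
      split_ifs at c <;> first | (exfalso; linarith) | omega

/-- The eigenvalue 0 has multiplicity n - (p + q) plus the number of cosines equal to 1, and a
multiplicity is nonnegative. In geometric terms, dim(X ∩ Z) ≥ p + q - n. -/
theorem sum_spectrum_card_eq_one (h0 : ∀ i, 0 ≤ s i)
    (h : Finset.univ.val.map α + Multiset.replicate (p + q) 0 + Multiset.replicate (2 * m) 1 =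
      Multiset.replicate n 0 + Multiset.replicate (p + q) 1 +
      Finset.univ.val.map (fun i => 1 + s i) + Finset.univ.val.map (fun i => 1 - s i)) :
    p + q ≤ n + (Finset.univ.filter fun i => s i = 1).card := by
  have c := count_of_sum_spectrum h (fun y => y = 0)
  have c1 : (Finset.univ.filter fun i => 1 + s i = 0).card = 0 :=
    card_filter_of_forall_not fun i => by linarith [h0 i]
  have c2 : (Finset.univ.filter fun i => 1 - s i = 0) = Finset.univ.filter fun i => s i = 1 :=
    Finset.filter_congr fun i _ => ⟨fun h => by linarith, fun h => by linarith⟩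
  rw [c1, c2] at c
  simp at c
  omega

theorem eq_one_of_sum_spectrum (hs : Antitone s) (h0 : ∀ i, 0 ≤ s i) (h1 : ∀ i, s i ≤ 1)
    (h : Finset.univ.val.map α + Multiset.replicate (p + q) 0 + Multiset.replicate (2 * m) 1 =
      Multiset.replicate n 0 + Multiset.replicate (p + q) 1 +
      Finset.univ.val.map (fun i => 1 + s i) + Finset.univ.val.map (fun i => 1 - s i))
    {j : Fin m} (hj : n + j < p + q) : s j = 1 := by
  refine le_antisymm (h1 j) (hs.le_of_lt_card_filter_le ?_)
  have c : (Finset.univ.filter fun i => s i = 1) = Finset.univ.filter fun i => 1 ≤ s i :=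
    Finset.filter_congr fun i _ => ⟨fun h => h.ge, fun h => le_antisymm (h1 i) h⟩
  have := sum_spectrum_card_eq_one h0 h
  rw [c] at this
  omega

end Spectrum

/-! ### Weak majorization from sums over index sets -/

section Majorization

theorem Fin.sum_filter_val_lt {n k : ℕ} (hk : k ≤ n) (f : Fin n → ℝ) :
    ∑ i : Fin n with i.val < k, f i = ∑ i : Fin k, f (Fin.castLE hk i) := by
  have : (Finset.univ.filter fun i : Fin n => i.val < k) =
      Finset.univ.map (Fin.castLEEmb hk) := by
    ext i
    simp only [Finset.mem_filter, Finset.mem_univ, true_and, Finset.mem_map, Fin.castLEEmb_apply]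
    exact ⟨fun h => ⟨⟨i, h⟩, rfl⟩, fun ⟨l, hl⟩ => hl ▸ l.isLt⟩
  rw [this, Finset.sum_map]
  rfl

theorem decreasingRearrangement_of_monotone {n : ℕ} {y : Fin n → ℝ} (hy : Monotone y) :
    decreasingRearrangement y = y ∘ Fin.rev := by
  have h : Monotone ((fun i => -y i) ∘ (Fin.revPerm : Equiv.Perm (Fin n))) := fun i j hij =>
    neg_le_neg (hy (Fin.rev_le_rev.2 hij))
  have := Tuple.comp_sort_eq_comp_iff_monotone.2 h
  funext i
  have := congrFun this i
  simpa [decreasingRearrangement] using this.symm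

/-- The k largest padded entries form a set of k places. Dropping the places with entry 0 keeps the
sum and leaves at most k indices, and `y ≥ 0` allows the bound to be extended back to k terms. Hence
only indices with `d j ≠ 0` need be tested, so zero entries need no matching eigenvalue. -/
theorem weaklyMajorizedBy_of_sum_le {m l : ℕ} {d : Fin m → ℝ} {y : Fin l → ℝ} (hml : m ≤ l)
    (hy : Monotone y) (hy0 : ∀ i, 0 ≤ y i)
    (h : ∀ J : Finset (Fin m), (∀ j ∈ J, d j ≠ 0) →
      ∑ j ∈ J, d j ≤ ∑ i : Fin l with i.val < J.card, y i.rev) : d ≺ʷ y := by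
  intro k _ hk
  generalize hN : max m l = N at hk ⊢
  obtain rfl : l = N := by omega
  have hpad : padZero l y = y := by
    funext i
    simp [padZero]
  rw [hpad, decreasingRearrangement_of_monotone hy]
  set σ := Tuple.sort (fun i => -padZero l d i)
  set T := (Finset.univ.filter fun i : Fin l => i.val < k).map σ.toEmbedding with hT
  have hTc : T.card ≤ k := by
    rw [hT, Finset.card_map, Fin.card_filter_val_lt]
    exact min_le_right _ _
  have h1 : ∑ i : Fin l with i.val < k, decreasingRearrangement (padZero l d) i =
      ∑ i ∈ T, padZero l d i := by
    rw [hT, Finset.sum_map]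
    rfl
  set J := Finset.univ.filter fun j : Fin m => Fin.castLE hml j ∈ T ∧ d j ≠ 0 with hJ
  have hsub : J.map (Fin.castLEEmb hml) ⊆ T := by
    intro i hi
    obtain ⟨j, hj, rfl⟩ := Finset.mem_map.1 hi
    exact (Finset.mem_filter.1 hj).2.1
  have h2 : ∑ i ∈ T, padZero l d i = ∑ j ∈ J, d j := by
    rw [← Finset.sum_subset hsub, Finset.sum_map]
    · refine Finset.sum_congr rfl fun j _ => ?_
      simp [padZero]
    · intro i hi hiJ
      by_contra hne
      simp only [padZero] at hne
      split_ifs at hne with him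
      · exact hiJ (Finset.mem_map.2 ⟨⟨i, him⟩, Finset.mem_filter.2 ⟨Finset.mem_univ _, hi, hne⟩, rfl⟩)
      · exact hne rfl
  have hJc : J.card ≤ k := by
    have := Finset.card_le_card hsub
    rw [Finset.card_map] at this
    omega
  rw [h1, h2]
  refine (h J fun j hj => (Finset.mem_filter.1 hj).2.2).trans ?_
  refine Finset.sum_le_sum_of_subset_of_nonneg (fun i hi => ?_) fun i _ _ => hy0 _
  simp only [Finset.mem_filter, Finset.mem_univ, true_and] at hi ⊢
  omega

/-- Choosing a place for every j in J is injective by `hinj`, so `hL` applies to a set of exactly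
`J.card` places. -/
theorem sum_abs_sub_le_of_matching {m n : ℕ} {a b : Fin m → ℝ} {α β γ : Fin n → ℝ}
    (hL : ∀ S : Finset (Fin n),
      ∑ i ∈ S, (α i - β i) ≤ ∑ i : Fin n with i.val < S.card, γ i)
    (R : Fin n → Fin m → Prop) (hR : ∀ i j, R i j → α i - β i = |a j - b j|)
    (hinj : ∀ i j j', R i j → R i j' → j = j') (J : Finset (Fin m))
    (hJ : ∀ j ∈ J, ∃ i, R i j) :
    ∑ j ∈ J, |a j - b j| ≤ ∑ i : Fin n with i.val < J.card, γ i := by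
  choose g hg using fun j : J => hJ j j.2
  have hgi : Function.Injective g := fun j j' h =>
    Subtype.ext (hinj (g j) j j' (hg j) (h ▸ hg j'))
  have := hL (Finset.univ.map ⟨g, hgi⟩)
  rw [Finset.sum_map, Finset.card_map, Finset.card_univ, Fintype.card_coe] at this
  rw [← Finset.sum_coe_sort]
  refine le_trans (le_of_eq (Finset.sum_congr rfl fun j _ => ?_)) this
  exact (hR _ _ (hg j)).symm

end Majorization

/-! ### From eigenvalues to principal angles -/

section PrincipalAngles

variable {𝕜 H : Type*} [RCLike 𝕜] [NormedAddCommGroup H] [InnerProductSpace 𝕜 H]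
  [FiniteDimensional 𝕜 H] (X Y Z : Submodule 𝕜 H)

theorem cos_principalAngles (i : Fin (min (finrank 𝕜 X) (finrank 𝕜 Z))) :
    Real.cos (principalAngles X Z i) = angleCosine X Z i :=
  Real.cos_arccos (neg_one_lt_zero.le.trans (angleCosine_nonneg X Z i))
    (angleCosine_le_one X Z i)

theorem sin_principalAngles (i : Fin (min (finrank 𝕜 X) (finrank 𝕜 Z))) :
    Real.sin (principalAngles X Z i) = angleSine X Z i :=
  Real.sin_arccos _

theorem angleSine_eq_zero_iff (i : ℕ) : angleSine X Z i = 0 ↔ angleCosine X Z i = 1 := by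
  have h := sq_angleSine X Z i
  have h0 := angleCosine_nonneg X Z i
  constructor
  · intro hs
    rw [hs] at h
    nlinarith
  · intro hc
    rw [hc] at h
    exact pow_eq_zero_iff two_ne_zero |>.1 (by linarith)

theorem add_finrank_le_card_angleSine_eq_zero :
    finrank 𝕜 X + finrank 𝕜 Z ≤ finrank 𝕜 H + (Finset.univ.filter
      fun i : Fin (min (finrank 𝕜 X) (finrank 𝕜 Z)) => angleSine X Z i = 0).card := by
  simp only [angleSine_eq_zero_iff]
  exact sum_spectrum_card_eq_one (fun i => angleCosine_nonneg X Z i) (sum_spectrum X Z rfl)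

theorem eigenvalues_difference_pos {i : Fin (finrank 𝕜 H)}
    {j : Fin (min (finrank 𝕜 X) (finrank 𝕜 Z))} (hij : i.val + 1 + j = finrank 𝕜 X) :
    (isSymmetric_starProjection_add_smul X Z (-1)).eigenvalues rfl i = angleSine X Z j :=
  difference_spectrum_apply_pos (s := fun j => angleSine X Z j)
    (LinearMap.IsSymmetric.eigenvalues_antitone _ _)
    (fun _ _ h => angleSine_monotone X Z h) (fun j => angleSine_nonneg X Z j)
    (fun j => angleSine_le_one X Z j) (min_le_left _ _) (difference_spectrum X Z rfl)
    (add_finrank_le_card_angleSine_eq_zero X Z) hij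

theorem eigenvalues_difference_neg {i : Fin (finrank 𝕜 H)}
    {j : Fin (min (finrank 𝕜 X) (finrank 𝕜 Z))}
    (hij : i.val + finrank 𝕜 Z = finrank 𝕜 H + j) :
    (isSymmetric_starProjection_add_smul X Z (-1)).eigenvalues rfl i = -angleSine X Z j :=
  difference_spectrum_apply_neg (s := fun j => angleSine X Z j)
    (LinearMap.IsSymmetric.eigenvalues_antitone _ _)
    (fun _ _ h => angleSine_monotone X Z h) (fun j => angleSine_nonneg X Z j)
    (fun j => angleSine_le_one X Z j) (difference_spectrum X Z rfl)
    (add_finrank_le_card_angleSine_eq_zero X Z) hij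

theorem eigenvalues_sum_pos {i : Fin (finrank 𝕜 H)}
    {j : Fin (min (finrank 𝕜 X) (finrank 𝕜 Z))} (hij : i.val = j) :
    (isSymmetric_starProjection_add_smul X Z 1).eigenvalues rfl i = 1 + angleCosine X Z j :=
  sum_spectrum_apply_pos (s := fun j => angleCosine X Z j)
    (LinearMap.IsSymmetric.eigenvalues_antitone _ _)
    (fun _ _ h => angleCosine_antitone X Z h) (fun j => angleCosine_nonneg X Z j)
    (min_le_left _ _) (min_le_right _ _) (sum_spectrum X Z rfl) hij

theorem eigenvalues_sum_neg {i : Fin (finrank 𝕜 H)}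
    {j : Fin (min (finrank 𝕜 X) (finrank 𝕜 Z))}
    (hij : i.val + 1 + j = finrank 𝕜 X + finrank 𝕜 Z) :
    (isSymmetric_starProjection_add_smul X Z 1).eigenvalues rfl i = 1 - angleCosine X Z j :=
  sum_spectrum_apply_neg (s := fun j => angleCosine X Z j)
    (LinearMap.IsSymmetric.eigenvalues_antitone _ _)
    (fun _ _ h => angleCosine_antitone X Z h) (fun j => angleCosine_nonneg X Z j)
    (fun j => angleCosine_le_one X Z j)
    (min_le_left _ _) (min_le_right _ _) (sum_spectrum X Z rfl) hij

theorem angleCosine_eq_one {j : Fin (min (finrank 𝕜 X) (finrank 𝕜 Z))}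
    (hj : finrank 𝕜 H + j < finrank 𝕜 X + finrank 𝕜 Z) : angleCosine X Z j = 1 :=
  eq_one_of_sum_spectrum (s := fun j => angleCosine X Z j)
    (fun _ _ h => angleCosine_antitone X Z h) (fun j => angleCosine_nonneg X Z j)
    (fun j => angleCosine_le_one X Z j) (sum_spectrum X Z rfl) hj

/-- If the entries of `|a - b|` are matched with differences of eigenvalues of `P_X + e P_Z` and
`P_Y + e P_Z`, then `|a - b|` is weakly majorized by the sines of the angles between `X`
and `Y`. -/
theorem abs_sub_weaklyMajorizedBy_sin (hXY : finrank 𝕜 X = finrank 𝕜 Y) (e : ℝ)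
    {a b : Fin (min (finrank 𝕜 X) (finrank 𝕜 Z)) → ℝ}
    (R : Fin (finrank 𝕜 H) → Fin (min (finrank 𝕜 X) (finrank 𝕜 Z)) → Prop)
    (hR : ∀ i j, R i j → (isSymmetric_starProjection_add_smul X Z e).eigenvalues rfl i -
      (isSymmetric_starProjection_add_smul Y Z e).eigenvalues rfl i = |a j - b j|)
    (hinj : ∀ i j j', R i j → R i j' → j = j') (hJ : ∀ j, a j ≠ b j → ∃ i, R i j) :
    (fun j => |a j - b j|) ≺ʷ fun i => Real.sin (principalAngles X Y i) := by
  simp only [sin_principalAngles]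
  refine weaklyMajorizedBy_of_sum_le (by omega) (fun _ _ h => angleSine_monotone X Y h)
    (fun i => angleSine_nonneg X Y i) fun J hJd => ?_
  have hC := isSymmetric_starProjection_add_smul X Y (-1)
  refine (sum_abs_sub_le_of_matching (γ := hC.eigenvalues rfl) (fun S =>
    LinearMap.IsSymmetric.sum_eigenvalues_sub_le _ _ hC ?_ rfl S) R hR hinj J
    fun j hj => hJ j fun h => hJd j hj (by simp [h])).trans (le_of_eq ?_)
  · push_cast
    module
  -- As dim X = dim Y, there are dim X sines between X and Y; they fill the first dim X places of
  -- the spectrum of P_X - P_Y in reversed order.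
  · have hJc : J.card ≤ min (finrank 𝕜 X) (finrank 𝕜 Z) := by simpa using J.card_le_univ
    have hXn := X.finrank_le
    rw [Fin.sum_filter_val_lt (by omega), Fin.sum_filter_val_lt (by omega)]
    refine Finset.sum_congr rfl fun i _ => ?_
    refine eigenvalues_difference_pos X Y ?_
    simp only [Fin.val_castLE, Fin.val_rev]
    omega

end PrincipalAngles

theorem theorem3p2 {𝕜 H : Type*} [RCLike 𝕜] [NormedAddCommGroup H] [InnerProductSpace 𝕜 H]
    [FiniteDimensional 𝕜 H] (X Y Z : Submodule 𝕜 H)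
    (hXY : Module.finrank 𝕜 X = Module.finrank 𝕜 Y) :
    ((fun i => |Real.sin (principalAngles X Z i) -
        Real.sin (principalAngles Y Z
          (Fin.cast (congrArg (fun d => min d (Module.finrank 𝕜 Z)) hXY) i))|) ≺ʷ
      fun i => Real.sin (principalAngles X Y i)) ∧
    ((fun i => |Real.cos (principalAngles X Z i) -
        Real.cos (principalAngles Y Z
          (Fin.cast (congrArg (fun d => min d (Module.finrank 𝕜 Z)) hXY) i))|) ≺ʷ
      fun i => Real.sin (principalAngles X Y i)) := by
  have hXn := X.finrank_le
  have hZn := Z.finrank_le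
  have hc : min (finrank 𝕜 X) (finrank 𝕜 Z) = min (finrank 𝕜 Y) (finrank 𝕜 Z) := by rw [hXY]
  constructor
  · have hY1 {i : Fin (finrank 𝕜 H)} {j : Fin (min (finrank 𝕜 X) (finrank 𝕜 Z))}
        (hij : i.val + 1 + j = finrank 𝕜 X) := eigenvalues_difference_pos Y Z (i := i)
      (j := Fin.cast hc j) (by simpa [← hXY] using hij)
    have hY2 {i : Fin (finrank 𝕜 H)} {j : Fin (min (finrank 𝕜 X) (finrank 𝕜 Z))}
        (hij : i.val + finrank 𝕜 Z = finrank 𝕜 H + j) := eigenvalues_difference_neg Y Z (i := i)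
      (j := Fin.cast hc j) (by simpa using hij)
    have hX0 := fun j => angleSine_nonneg X Z j
    have hY0 := fun j => angleSine_nonneg Y Z j
    -- When p + q > n a place may belong to both families. Its eigenvalue is then both a sine and
    -- the negative of one, hence 0, and no sine for Y lies strictly below 0.
    have hcol : ∀ (i : Fin (finrank 𝕜 H)) (j j' : Fin (min (finrank 𝕜 X) (finrank 𝕜 Z))),
        i.val + 1 + j = finrank 𝕜 X → angleSine Y Z j < angleSine X Z j →
        i.val + finrank 𝕜 Z = finrank 𝕜 H + j' → False := fun i j j' h h' h'' => by
      have e1 := eigenvalues_difference_pos X Z h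
      rw [eigenvalues_difference_neg X Z h''] at e1
      linarith [hX0 j, hX0 j', hY0 j]
    simp only [sin_principalAngles, Fin.val_cast]
    have := abs_sub_weaklyMajorizedBy_sin X Y Z hXY (-1)
      (a := fun j => angleSine X Z j) (b := fun j => angleSine Y Z j)
      -- A positive difference uses the place of +sin, a negative one that of -sin, so the
      -- eigenvalue difference is the absolute value.
      (fun i j => (i.val + 1 + j = finrank 𝕜 X ∧ angleSine Y Z j < angleSine X Z j) ∨
        (i.val + finrank 𝕜 Z = finrank 𝕜 H + j ∧ angleSine X Z j < angleSine Y Z j)) ?_ ?_ ?_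
    · simpa only [sin_principalAngles] using this
    · rintro i j (⟨h, h'⟩ | ⟨h, h'⟩)
      · rw [eigenvalues_difference_pos X Z h, hY1 h, abs_of_pos (sub_pos.2 h'), Fin.val_cast]
      · rw [eigenvalues_difference_neg X Z h, hY2 h, abs_of_neg (sub_neg.2 h'), Fin.val_cast]
        ring
    · rintro i j j' (⟨h, h'⟩ | ⟨h, h'⟩) (⟨g, g'⟩ | ⟨g, g'⟩)
      · exact Fin.ext (by omega)
      · exact (hcol i j j' h h' g).elim
      · exact (hcol i j' j g g' h).elim
      · exact Fin.ext (by omega)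
    · intro j hj
      have := j.isLt
      rcases hj.lt_or_gt with h | h
      · exact ⟨⟨finrank 𝕜 H - finrank 𝕜 Z + j, by omega⟩, Or.inr ⟨by simp only; omega, h⟩⟩
      · exact ⟨⟨finrank 𝕜 X - 1 - j, by omega⟩, Or.inl ⟨by simp only; omega, h⟩⟩
  · have hY1 {i : Fin (finrank 𝕜 H)} {j : Fin (min (finrank 𝕜 X) (finrank 𝕜 Z))}
        (hij : i.val = j) := eigenvalues_sum_pos Y Z (i := i)
      (j := Fin.cast hc j) (by simpa using hij)
    have hY2 {i : Fin (finrank 𝕜 H)} {j : Fin (min (finrank 𝕜 X) (finrank 𝕜 Z))}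
        (hij : i.val + 1 + j = finrank 𝕜 X + finrank 𝕜 Z) := eigenvalues_sum_neg Y Z (i := i)
      (j := Fin.cast hc j) (by simpa [← hXY] using hij)
    simp only [cos_principalAngles, Fin.val_cast]
    refine abs_sub_weaklyMajorizedBy_sin X Y Z hXY 1
      (a := fun j => angleCosine X Z j) (b := fun j => angleCosine Y Z j)
      (fun i j => (i.val = j ∧ angleCosine Y Z j < angleCosine X Z j) ∨
        (i.val + 1 + j = finrank 𝕜 X + finrank 𝕜 Z ∧
          angleCosine X Z j < angleCosine Y Z j)) ?_ ?_ ?_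
    · rintro i j (⟨h, h'⟩ | ⟨h, h'⟩)
      · rw [eigenvalues_sum_pos X Z h, hY1 h, abs_of_pos (sub_pos.2 h'), Fin.val_cast]
        ring
      · rw [eigenvalues_sum_neg X Z h, hY2 h, abs_of_neg (sub_neg.2 h'), Fin.val_cast]
        ring
    · rintro i j j' (⟨h, h'⟩ | ⟨h, h'⟩) (⟨g, g'⟩ | ⟨g, g'⟩) <;> exact Fin.ext (by omega)
    · intro j hj
      have := j.isLt
      rcases hj.lt_or_gt with h | h
      -- The place p+q-1-j might fall outside the n available ones, but then the cosine for X would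
      -- be 1 and could not be strictly smaller than the one for Y.
      · have hlt : ¬ finrank 𝕜 H + j < finrank 𝕜 X + finrank 𝕜 Z := fun hlt =>
          h.not_ge ((angleCosine_le_one Y Z j).trans (angleCosine_eq_one X Z hlt).ge)
        exact ⟨⟨finrank 𝕜 X + finrank 𝕜 Z - 1 - j, by omega⟩, Or.inr ⟨by simp only; omega, h⟩⟩
      · exact ⟨⟨j, by omega⟩, Or.inl ⟨rfl, h⟩⟩
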